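/- **Setting.** Let $X,\Omega$ be locally compact Hausdorff spaces, $\phi\in C_0(X\times\Omega)$ real-valued, and $(\mathcal U,\mathcal U^\diamond)$ a dual pair of real Banach spaces with a continuous bilinear pairing $\langle\cdot,\cdot\rangle_{\mathcal U}:\mathcal U^\diamond\times\mathcal U\to\mathbb R$ that is non-degenerate in both arguments. Let $\mathcal M(\Omega;\mathcal U)$ be the space of countably additive $\mathcal U$-valued Borel vector measures on $\Omega$ whose total variation measure is finite and regular, and similarly $\mathcal M(X;\mathcal U^\diamond)$. For $\mu\in\mathcal M(\Omega;\mathcal U)$ and $\rho\in\mathcal M(X;\mathcal U^\diamond)$ put $$(A\mu)(x)=\int_\Omega\phi(x,w)\,d\mu(w),\qquad (A^\diamond\rho)(w)=\int_X\phi(x,w)\,d\rho(x).$$ The integral vv-RKBS is the pair of normed function spaces $$\mathcal B=\{A\mu\mid\mu\in\mathcal M(\Omega;\mathcal U)\},\ \ \|f\|_{\mathcal B}=\inf_{f=A\mu}|\mu|(\Omega),\qquad \mathcal B^\diamond=\{A^\diamond\rho\mid\rho\in\mathcal M(X;\mathcal U^\diamond)\},\ \ \|g\|_{\mathcal B^\diamond}=\sup_{w\in\Omega}\|g(w)\|_{\mathcal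 U^\diamond},$$ with the (well-defined, bilinear) pairing $\langle A^\diamond\rho,A\mu\rangle_{\mathcal B}=\int_{X\times\Omega}\phi\,d\langle\rho,\mu\rangle_{\mathcal U}$, where $\langle\rho,\mu\rangle_{\mathcal U}$ is the signed measure on the product $\sigma$-algebra with $\langle\rho,\mu\rangle_{\mathcal U}(E\times F)=\langle\rho(E),\mu(F)\rangle_{\mathcal U}$ for Borel sets $E\subseteq X$, $F\subseteq\Omega$. The kernel is $K(x,w)(u^\diamond,u)=\phi(x,w)\langle u^\diamond,u\rangle_{\mathcal U}$, with $K_{\mathcal U^\diamond}(x,w)u^\diamond=\phi(x,w)u^\diamond$. For $x\in X$ and $u^\diamond\in\mathcal U^\diamond$ let $\delta_{x,u^\diamond}\in\mathcal B^*$ be $\delta_{x,u^\diamond}(f)=\langle u^\diamond,f(x)\rangle_{\mathcal U}$; the $\delta$-dual of $\mathcal B$ is the closure $\overline\Delta$ in $\mathcal B^*$ of $\Delta=\operatorname{span}\{\delta_{x,u^\diamond}\mid x\in X,\ u^\diamond\in\mathcal U^\diamond\}$. **Theorem.** The linear span of $\{K_{\mathcal U^\diamond}(x,\cdot)u^\diamond\mid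 x\in X,\ u^\diamond\in\mathcal U^\diamond\}=\{\phi(x,\cdot)u^\diamond\mid x\in X,\ u^\diamond\in\mathcal U^\diamond\}$ is contained and dense in $\mathcal B^\diamond$. If, moreover, $$\|u^\diamond\|_{\mathcal U^\diamond}=\sup_{\|u\|_{\mathcal U}\le1}|\langle u^\diamond,u\rangle_{\mathcal U}|\quad\text{for all }u^\diamond\in\mathcal U^\diamond,$$ then $$\|g\|_{\mathcal B^\diamond}=\sup_{\|f\|_{\mathcal B}\le1}|\langle g,f\rangle_{\mathcal B}|\quad\text{for all }g\in\mathcal B^\diamond,$$ and $\mathcal B^\diamond$ is a $\delta$-dual in the following sense: $\iota(g)=\langle g,\cdot\rangle_{\mathcal B}$ defines a linear isometry $\iota:\mathcal B^\diamond\to\mathcal B^*$ with $\iota(K_{\mathcal U^\diamond}(x,\cdot)u^\diamond)=\delta_{x,u^\diamond}$ for all $x,u^\diamond$, whose range has closure $\overline\Delta$; if $\mathcal B^\diamond$ is complete, then $\iota$ maps $\mathcal B^\diamond$ isometrically onto $\overline\Delta$. -/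

import Mathlib

set_option linter.unusedSectionVars false

open MeasureTheory Set Filter Topology
open scoped ZeroAtInfty BoundedContinuousFunction ENNReal

namespace VVRKBS

section Fubini
variable {X Y E F : Type*} {mX : MeasurableSpace X} {mY : MeasurableSpace Y}
  [NormedAddCommGroup E] [NormedSpace ℝ E] [NormedAddCommGroup F] [NormedSpace ℝ F] [CompleteSpace F]

lemma fubini_simple (μ : VectorMeasure X E) (ν : VectorMeasure Y F) (β : E →L[ℝ] F →L[ℝ] ℝ)
    [IsFiniteMeasure μ.variation] [IsFiniteMeasure ν.variation] (s : SimpleFunc (X × Y) ℝ) :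
    StronglyMeasurable (fun x => ∫ᵛ y, s (x, y) ∂•ν) ∧
    ∫ᵛ z, s z ∂•(μ.prod ν β) = ∫ᵛ x, (∫ᵛ y, s (x, y) ∂•ν) ∂[β.flip; μ] := by
  have hbd : ∀ f : SimpleFunc (X × Y) ℝ, ∃ C, ∀ z, ‖f z‖ ≤ C := fun f => by
    obtain ⟨C, hC⟩ := f.exists_forall_norm_le
    exact ⟨C, hC⟩
  have hint : ∀ (f : SimpleFunc (X × Y) ℝ) (x : X), ν.Integrable (fun y => f (x, y)) := by
    intro f x
    obtain ⟨C, hC⟩ := hbd f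
    refine Integrable.of_bound (f.stronglyMeasurable.comp_measurable
      measurable_prodMk_left).aestronglyMeasurable C (Eventually.of_forall fun y => hC _)
  induction s using SimpleFunc.induction with
  | @const c s hs =>
    have h1 : ∀ x, ∫ᵛ y, (SimpleFunc.piecewise s hs (SimpleFunc.const _ c) (SimpleFunc.const _ 0)) (x, y) ∂•ν
        = c • ν (Prod.mk x ⁻¹' s) := by
      intro x
      have : (fun y => (SimpleFunc.piecewise s hs (SimpleFunc.const _ c) (SimpleFunc.const _ 0)) (x, y))
          = (Prod.mk x ⁻¹' s).indicator (fun _ => c) := by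
        ext y
        simp [SimpleFunc.coe_piecewise, Set.piecewise, Set.indicator]
        rfl
      rw [this, VectorMeasure.integral_indicator_const _ (measurable_prodMk_left hs)]
      simp
    simp_rw [h1]
    refine ⟨(VectorMeasure.stronglyMeasurable_vectorMeasure_prodMk_left hs).const_smul c, ?_⟩
    have h2 : (⇑(SimpleFunc.piecewise s hs (SimpleFunc.const _ c) (SimpleFunc.const _ 0)) : X × Y → ℝ)
          = s.indicator (fun _ => c) := by
        ext y; simp [SimpleFunc.coe_piecewise, Set.piecewise, Set.indicator]
    have h3 := VectorMeasure.integral_indicator_const (μ := μ.prod ν β)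
      (B := ContinuousLinearMap.lsmul ℝ ℝ) c hs
    rw [h2, h3, VectorMeasure.integral_fun_smul, VectorMeasure.prod_apply_eq_integral hs]
    simp
  | @add f g hd hf hg =>
    have h1 : ∀ x, ∫ᵛ y, (f + g) (x, y) ∂•ν = ∫ᵛ y, f (x, y) ∂•ν + ∫ᵛ y, g (x, y) ∂•ν := by
      intro x
      simp only [SimpleFunc.coe_add, Pi.add_apply]
      exact VectorMeasure.integral_fun_add (hint f x) (hint g x)
    simp_rw [h1]
    refine ⟨hf.1.add hg.1, ?_⟩
    have hi : ∀ f : SimpleFunc (X × Y) ℝ, (μ.prod ν β).Integrable (fun z => f z) := by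
      intro f
      obtain ⟨C, hC⟩ := hbd f
      exact Integrable.of_bound f.stronglyMeasurable.aestronglyMeasurable C
        (Eventually.of_forall fun y => hC _)
    have hj : ∀ f : SimpleFunc (X × Y) ℝ, StronglyMeasurable (fun x => ∫ᵛ y, f (x, y) ∂•ν) →
        μ.Integrable (fun x => ∫ᵛ y, f (x, y) ∂•ν) := by
      intro f hf
      obtain ⟨C, hC⟩ := hbd f
      exact Integrable.of_bound hf.aestronglyMeasurable _ (Eventually.of_forall fun x =>
        VectorMeasure.norm_integral_le_of_norm_le_const (Eventually.of_forall fun y => hC _))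
    rw [VectorMeasure.integral_fun_add (hj f hf.1) (hj g hg.1), ← hf.2, ← hg.2]
    simp only [SimpleFunc.coe_add, Pi.add_apply]
    exact VectorMeasure.integral_fun_add (hi f) (hi g)

lemma fubini_bounded (μ : VectorMeasure X E) (ν : VectorMeasure Y F) (β : E →L[ℝ] F →L[ℝ] ℝ)
    [IsFiniteMeasure μ.variation] [IsFiniteMeasure ν.variation] {f : X × Y → ℝ}
    (hf : StronglyMeasurable f) {C : ℝ} (hC : ∀ z, ‖f z‖ ≤ C) :
    StronglyMeasurable (fun x => ∫ᵛ y, f (x, y) ∂•ν) ∧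
    ∫ᵛ z, f z ∂•(μ.prod ν β) = ∫ᵛ x, (∫ᵛ y, f (x, y) ∂•ν) ∂[β.flip; μ] := by
  have hC0 : 0 ≤ max C 0 := le_max_right _ _
  set s : ℕ → SimpleFunc (X × Y) ℝ := hf.approxBounded (max C 0) with hs
  have hsb : ∀ n z, ‖s n z‖ ≤ max C 0 := fun n z => hf.norm_approxBounded_le hC0 n z
  have hst : ∀ z, Tendsto (fun n => s n z) atTop (𝓝 (f z)) := fun z =>
    hf.tendsto_approxBounded_of_norm_le ((hC z).trans (le_max_left _ _))
  have hin : ∀ x, Tendsto (fun n => ∫ᵛ y, s n (x, y) ∂•ν) atTop (𝓝 (∫ᵛ y, f (x, y) ∂•ν)) := by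
    intro x
    refine VectorMeasure.tendsto_integral_filter_of_norm_le_const
      (Eventually.of_forall fun n => ((s n).stronglyMeasurable.comp_measurable
        measurable_prodMk_left).aestronglyMeasurable)
      ⟨max C 0, Eventually.of_forall fun n => Eventually.of_forall fun y => hsb n _⟩
      (Eventually.of_forall fun y => hst _)
  refine ⟨stronglyMeasurable_of_tendsto atTop (fun n => (fubini_simple μ ν β (s n)).1)
    (tendsto_pi_nhds.2 hin), ?_⟩
  have h1 : Tendsto (fun n => ∫ᵛ z, s n z ∂•(μ.prod ν β)) atTop
      (𝓝 (∫ᵛ z, f z ∂•(μ.prod ν β))) :=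
    VectorMeasure.tendsto_integral_filter_of_norm_le_const
      (Eventually.of_forall fun n => (s n).stronglyMeasurable.aestronglyMeasurable)
      ⟨max C 0, Eventually.of_forall fun n => Eventually.of_forall fun y => hsb n _⟩
      (Eventually.of_forall fun y => hst _)
  have h2 : Tendsto (fun n => ∫ᵛ x, (∫ᵛ y, s n (x, y) ∂•ν) ∂[β.flip; μ]) atTop
      (𝓝 (∫ᵛ x, (∫ᵛ y, f (x, y) ∂•ν) ∂[β.flip; μ])) :=
    VectorMeasure.tendsto_integral_filter_of_norm_le_const
      (Eventually.of_forall fun n => (fubini_simple μ ν β (s n)).1.aestronglyMeasurable)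
      ⟨_, Eventually.of_forall fun n => Eventually.of_forall fun x =>
        VectorMeasure.norm_integral_le_of_norm_le_const (Eventually.of_forall fun y => hsb n _)⟩
      (Eventually.of_forall hin)
  refine tendsto_nhds_unique h1 (h2.congr fun n => ((fubini_simple μ ν β (s n)).2).symm)

lemma fubini_bounded_swap [CompleteSpace E] (μ : VectorMeasure X E) (ν : VectorMeasure Y F)
    (β : E →L[ℝ] F →L[ℝ] ℝ)
    [IsFiniteMeasure μ.variation] [IsFiniteMeasure ν.variation] {f : X × Y → ℝ}
    (hf : StronglyMeasurable f) {C : ℝ} (hC : ∀ z, ‖f z‖ ≤ C) :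
    StronglyMeasurable (fun y => ∫ᵛ x, f (x, y) ∂•μ) ∧
    ∫ᵛ z, f z ∂•(μ.prod ν β) = ∫ᵛ y, (∫ᵛ x, f (x, y) ∂•μ) ∂[β; ν] := by
  have h := fubini_bounded ν μ β.flip (f := fun z => f z.swap)
    (hf.comp_measurable measurable_swap) (fun z => hC _)
  refine ⟨h.1, ?_⟩
  have h2 : μ.prod ν β = (ν.prod μ β.flip).map (MeasurableEquiv.prodComm : Y × X ≃ᵐ X × Y) := by
    apply VectorMeasure.prod_eq_of_forall_apply_prod
    intro s t hs ht
    rw [VectorMeasure.map_apply _ (MeasurableEquiv.measurable _) (hs.prod ht)]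
    have : (MeasurableEquiv.prodComm : Y × X ≃ᵐ X × Y) ⁻¹' (s ×ˢ t) = t ×ˢ s := by
      ext ⟨a, b⟩
      exact and_comm
    rw [this]; simp
  rw [h2, VectorMeasure.integral_map_equiv]
  exact h.2

end Fubini

/-- A continuous function vanishing at infinity on a product is measurable for the product of the
Borel `σ`-algebras, even if the product is not second countable. -/
lemma stronglyMeasurable_C0_prod {X Ω : Type*} [TopologicalSpace X] [MeasurableSpace X]
    [OpensMeasurableSpace X] [TopologicalSpace Ω] [MeasurableSpace Ω] [OpensMeasurableSpace Ω]
    [T2Space X] [T2Space Ω] (φ : C₀(X × Ω, ℝ)) : StronglyMeasurable (fun z => φ z) := by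
  let c : ℕ → X × Ω → ℝ := fun n z => φ z - max (-(1 / ((n : ℝ) + 1))) (min (φ z) (1 / ((n : ℝ) + 1)))
  have hpos : ∀ n : ℕ, 0 < 1 / ((n : ℝ) + 1) := fun n => by positivity
  have hcc : ∀ n, Continuous (c n) := fun n => by fun_prop
  have hcs : ∀ n, HasCompactSupport (c n) := by
    intro n
    have h := φ.zero_at_infty'
    rw [Metric.tendsto_nhds] at h
    obtain ⟨K, hK, hKs⟩ := mem_cocompact.1 (h _ (hpos n))
    refine HasCompactSupport.intro hK fun z hz => ?_
    have hz' := hKs hz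
    simp only [Set.mem_ofPred_eq, dist_zero_right, Real.norm_eq_abs] at hz'
    have h2 := abs_lt.1 hz'
    have h2a : -(1 / ((n : ℝ) + 1)) < φ z := h2.1
    have h2b : φ z < 1 / ((n : ℝ) + 1) := h2.2
    simp only [c]
    rw [min_eq_left h2b.le, max_eq_right h2a.le, sub_self]
  refine stronglyMeasurable_of_tendsto atTop
    (fun n => (hcs n).stronglyMeasurable_of_prod (hcc n)) (tendsto_pi_nhds.2 fun z => ?_)
  have hl := tendsto_one_div_add_atTop_nhds_zero_nat (𝕜 := ℝ)
  have : Tendsto (fun n => c n z) atTop (𝓝 (φ z - max (-0) (min (φ z) 0))) :=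
    tendsto_const_nhds.sub (hl.neg.max (tendsto_const_nhds.min hl))
  have h0 : max (-0 : ℝ) (min (φ z) 0) = 0 := by simp
  rwa [h0, sub_zero] at this


section Spaces

variable {X Y Z Ω : Type*} [TopologicalSpace X] [T2Space X] [MeasurableSpace X] [BorelSpace X]
  [TopologicalSpace Z] [T2Space Z] [MeasurableSpace Z] [BorelSpace Z]
  [TopologicalSpace Ω] [T2Space Ω] [MeasurableSpace Ω] [BorelSpace Ω]
  {V U U' : Type*} [NormedAddCommGroup V] [NormedSpace ℝ V]
  [NormedAddCommGroup U] [NormedSpace ℝ U] [NormedAddCommGroup U'] [NormedSpace ℝ U']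

/-- A Borel measure dominated by a finite regular Borel measure is regular. -/
lemma regular_of_le {m ν : Measure Z} [IsFiniteMeasure m] [m.InnerRegular]
    (h : ν ≤ m) : ν.Regular := by
  have hν : IsFiniteMeasure ν := isFiniteMeasure_of_le m h
  have : ν.InnerRegular := by
    refine ⟨fun A hA r hr => ?_⟩
    obtain ⟨K, hKA, hK, hKm⟩ := hA.exists_isCompact_sdiff_lt (μ := m)
      (measure_ne_top m A) (ε := ν A - r) (tsub_pos_of_lt hr).ne'
    refine ⟨K, hKA, hK, ?_⟩
    have h1 : ν A ≤ ν K + ν (A \ K) := by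
      rw [← measure_union_add_inter' hK.measurableSet]
      exact le_add_right (measure_mono (by simp))
    by_contra hle
    have h3 : ν A < r + (ν A - r) := h1.trans_lt
      (ENNReal.add_lt_add_of_le_of_lt (measure_ne_top ν K) (not_lt.1 hle) ((h _).trans_lt hKm))
    rw [add_tsub_cancel_of_le hr.le] at h3
    exact lt_irrefl _ h3
  infer_instance

/-- `𝓜(Z; V)`: the `V`-valued countably additive Borel vector measures on `Z` whose total variation
is finite and regular. -/
def radonMeasures (Z V : Type*) [TopologicalSpace Z] [T2Space Z] [MeasurableSpace Z] [BorelSpace Z]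
    [NormedAddCommGroup V] [NormedSpace ℝ V] : Submodule ℝ (VectorMeasure Z V) where
  carrier := {μ | IsFiniteMeasure μ.variation ∧ μ.variation.Regular}
  zero_mem' := by
    constructor
    · simp; infer_instance
    · simp; infer_instance
  add_mem' := by
    rintro μ ν ⟨h1, h2⟩ ⟨h3, h4⟩
    have : IsFiniteMeasure (μ + ν).variation :=
      isFiniteMeasure_of_le _ VectorMeasure.variation_add_le
    exact ⟨this, regular_of_le (m := μ.variation + ν.variation) VectorMeasure.variation_add_le⟩
  smul_mem' := by
    rintro c μ ⟨h1, h2⟩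
    refine ⟨inferInstance, ?_⟩
    rw [VectorMeasure.variation_smul]
    exact Measure.Regular.smul (by simp)

instance (μ : radonMeasures Z V) : IsFiniteMeasure (μ : VectorMeasure Z V).variation := μ.2.1

/-- The total variation norm `|μ|(Z)`. -/
noncomputable def tv (μ : radonMeasures Z V) : ℝ :=
  ((μ : VectorMeasure Z V).variation univ).toReal

lemma dirac_mem (z : Z) (v : V) : VectorMeasure.dirac z v ∈ radonMeasures Z V := by
  refine ⟨inferInstance, ?_⟩
  rw [VectorMeasure.variation_dirac]
  have : (Measure.dirac z).Regular := by
    have : (Measure.dirac z).InnerRegular := by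
      refine ⟨fun A hA r hr => ?_⟩
      rw [Measure.dirac_apply' _ hA] at hr
      by_cases hz : z ∈ A
      · rw [Set.indicator_of_mem hz] at hr
        exact ⟨{z}, by simpa using hz, isCompact_singleton, by
          rwa [Measure.dirac_apply_of_mem (Set.mem_singleton z)]⟩
      · simp [hz] at hr
    infer_instance
  exact Measure.Regular.smul (by simp)

lemma integrable_bcf (k : Z →ᵇ ℝ) (μ : VectorMeasure Z V) [IsFiniteMeasure μ.variation] :
    μ.Integrable (fun z => k z) :=
  Integrable.of_bound k.continuous.stronglyMeasurable.aestronglyMeasurable ‖k‖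
    (Eventually.of_forall k.norm_coe_le_norm)

/-- The operator `(A μ)(y) = ∫ k(y, z) dμ(z)`. -/
noncomputable def integralOp (V : Type*) [NormedAddCommGroup V] [NormedSpace ℝ V]
    (k : Y → Z →ᵇ ℝ) : radonMeasures Z V →ₗ[ℝ] (Y → V) where
  toFun μ y := ∫ᵛ z, k y z ∂•(μ : VectorMeasure Z V)
  map_add' μ ν := by
    funext y
    exact VectorMeasure.integral_add_vectorMeasure (integrable_bcf _ _) (integrable_bcf _ _)
  map_smul' c μ := by
    funext y
    exact VectorMeasure.integral_smul_vectorMeasure _ _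

lemma norm_integralOp_le (k : Y → Z →ᵇ ℝ) (μ : radonMeasures Z V) (y : Y) :
    ‖integralOp V k μ y‖ ≤ ‖k y‖ * tv μ := by
  refine (VectorMeasure.norm_integral_le_of_norm_le_const
    (Eventually.of_forall (k y).norm_coe_le_norm)).trans ?_
  have : ‖(ContinuousLinearMap.lsmul ℝ ℝ : ℝ →L[ℝ] V →L[ℝ] V)‖ ≤ 1 :=
    ContinuousLinearMap.opNorm_lsmul_le
  have h2 : 0 ≤ tv μ := ENNReal.toReal_nonneg
  have h3 : (μ : VectorMeasure Z V).variation.real univ = tv μ := rfl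
  rw [h3]
  nlinarith [mul_nonneg (norm_nonneg (k y)) h2]

lemma tv_nonneg (μ : radonMeasures Z V) : 0 ≤ tv μ := ENNReal.toReal_nonneg

lemma tv_zero : tv (0 : radonMeasures Z V) = 0 := by simp [tv]

lemma tv_add_le (μ ν : radonMeasures Z V) : tv (μ + ν) ≤ tv μ + tv ν := by
  unfold tv
  rw [← ENNReal.toReal_add (measure_ne_top _ _) (measure_ne_top _ _)]
  refine ENNReal.toReal_mono (by simp) ?_
  exact VectorMeasure.variation_add_le (μ := (μ : VectorMeasure Z V)) (ν := (ν : VectorMeasure Z V)) univ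

lemma tv_smul (c : ℝ) (μ : radonMeasures Z V) : tv (c • μ) = |c| * tv μ := by
  simp [tv, VectorMeasure.variation_smul]

/-- The section `φ(x, ·)` as a bounded continuous function on `Ω`. -/
noncomputable def sectionX (φ : C₀(X × Ω, ℝ)) (x : X) : Ω →ᵇ ℝ :=
  BoundedContinuousFunction.ofNormedAddCommGroup (fun w => φ (x, w)) (by fun_prop) ‖φ‖
    (fun w => φ.toBCF.norm_coe_le_norm (x, w))

/-- The section `φ(·, w)` as a bounded continuous function on `X`. -/
noncomputable def sectionΩ (φ : C₀(X × Ω, ℝ)) (w : Ω) : X →ᵇ ℝ :=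
  BoundedContinuousFunction.ofNormedAddCommGroup (fun x => φ (x, w)) (by fun_prop) ‖φ‖
    (fun x => φ.toBCF.norm_coe_le_norm (x, w))

/-- `(A_{Ω→X} μ)(x) = ∫_Ω φ(x, w) dμ(w)`. -/
noncomputable def opΩX (φ : C₀(X × Ω, ℝ)) (U : Type*) [NormedAddCommGroup U] [NormedSpace ℝ U] :
    radonMeasures Ω U →ₗ[ℝ] (X → U) :=
  integralOp U (sectionX φ)

/-- `(A_{X→Ω} ρ)(w) = ∫_X φ(x, w) dρ(x)`. -/
noncomputable def opXΩ (φ : C₀(X × Ω, ℝ)) (U' : Type*) [NormedAddCommGroup U'] [NormedSpace ℝ U'] :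
    radonMeasures X U' →ₗ[ℝ] (Ω → U') :=
  integralOp U' (sectionΩ φ)

lemma opΩX_apply (φ : C₀(X × Ω, ℝ)) (μ : radonMeasures Ω U) (x : X) :
    opΩX φ U μ x = ∫ᵛ w, φ (x, w) ∂•(μ : VectorMeasure Ω U) := rfl

lemma opXΩ_apply (φ : C₀(X × Ω, ℝ)) (ρ : radonMeasures X U') (w : Ω) :
    opXΩ φ U' ρ w = ∫ᵛ x, φ (x, w) ∂•(ρ : VectorMeasure X U') := rfl

/-- The space `𝓑 = {A_{Ω→X} μ | μ ∈ 𝓜(Ω; U)}` of functions `X → U`. -/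
def SpaceB (φ : C₀(X × Ω, ℝ)) (U : Type*) [NormedAddCommGroup U] [NormedSpace ℝ U] : Type _ :=
  LinearMap.range (opΩX φ U)

/-- The space `𝓑^◇ = {A_{X→Ω} ρ | ρ ∈ 𝓜(X; U')}` of functions `Ω → U'`. -/
def SpaceBDiamond (φ : C₀(X × Ω, ℝ)) (U' : Type*) [NormedAddCommGroup U'] [NormedSpace ℝ U'] :
    Type _ :=
  LinearMap.range (opXΩ φ U')

section Norms
variable (φ : C₀(X × Ω, ℝ))

noncomputable instance : AddCommGroup (SpaceB φ U) :=
  inferInstanceAs (AddCommGroup (LinearMap.range (opΩX φ U)))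

noncomputable instance : Module ℝ (SpaceB φ U) :=
  inferInstanceAs (Module ℝ (LinearMap.range (opΩX φ U)))

instance : CoeFun (SpaceB φ U) (fun _ => X → U) := ⟨Subtype.val⟩

noncomputable instance : AddCommGroup (SpaceBDiamond φ U') :=
  inferInstanceAs (AddCommGroup (LinearMap.range (opXΩ φ U')))

noncomputable instance : Module ℝ (SpaceBDiamond φ U') :=
  inferInstanceAs (Module ℝ (LinearMap.range (opXΩ φ U')))

instance : CoeFun (SpaceBDiamond φ U') (fun _ => Ω → U') := ⟨Subtype.val⟩

/-- The element `A_{Ω→X} μ` of `𝓑`. -/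
noncomputable def SpaceB.of (μ : radonMeasures Ω U) : SpaceB φ U := ⟨opΩX φ U μ, μ, rfl⟩

/-- The element `A_{X→Ω} ρ` of `𝓑^◇`. -/
noncomputable def SpaceBDiamond.of (ρ : radonMeasures X U') : SpaceBDiamond φ U' :=
  ⟨opXΩ φ U' ρ, ρ, rfl⟩

/-- `‖f‖_𝓑 = inf {|μ|(Ω) | f = A_{Ω→X} μ}`. -/
noncomputable instance : Norm (SpaceB φ U) :=
  ⟨fun f => sInf {r : ℝ | ∃ μ : radonMeasures Ω U, SpaceB.of φ μ = f ∧ tv μ = r}⟩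

/-- `‖g‖_{𝓑^◇} = sup_w ‖g(w)‖`. -/
noncomputable instance : Norm (SpaceBDiamond φ U') := ⟨fun g => ⨆ w, ‖g w‖⟩

variable {φ}

lemma SpaceB.of_surjective (f : SpaceB φ U) : ∃ μ : radonMeasures Ω U, SpaceB.of φ μ = f := by
  obtain ⟨_, μ, rfl⟩ := f
  exact ⟨μ, rfl⟩

lemma SpaceBDiamond.of_surjective (g : SpaceBDiamond φ U') :
    ∃ ρ : radonMeasures X U', SpaceBDiamond.of φ ρ = g := by
  obtain ⟨_, ρ, rfl⟩ := g
  exact ⟨ρ, rfl⟩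

lemma SpaceB.norm_le (μ : radonMeasures Ω U) : ‖SpaceB.of φ μ‖ ≤ tv μ :=
  csInf_le ⟨0, by rintro _ ⟨ν, -, rfl⟩; exact tv_nonneg ν⟩ ⟨μ, rfl, rfl⟩

lemma SpaceB.le_norm (f : SpaceB φ U) {r : ℝ}
    (h : ∀ μ : radonMeasures Ω U, SpaceB.of φ μ = f → r ≤ tv μ) : r ≤ ‖f‖ := by
  obtain ⟨μ, hμ⟩ := f.of_surjective
  exact le_csInf ⟨_, μ, hμ, rfl⟩ (by rintro _ ⟨ν, hν, rfl⟩; exact h ν hν)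

lemma SpaceB.exists_tv_lt (f : SpaceB φ U) {r : ℝ} (hr : ‖f‖ < r) :
    ∃ μ : radonMeasures Ω U, SpaceB.of φ μ = f ∧ tv μ < r := by
  by_contra! h
  exact absurd (f.le_norm h) (not_le.2 hr)

lemma norm_sectionX_le (x : X) : ‖sectionX φ x‖ ≤ ‖φ‖ :=
  BoundedContinuousFunction.norm_ofNormedAddCommGroup_le _ (norm_nonneg _) _

lemma norm_sectionΩ_le (w : Ω) : ‖sectionΩ φ w‖ ≤ ‖φ‖ :=
  BoundedContinuousFunction.norm_ofNormedAddCommGroup_le _ (norm_nonneg _) _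

lemma SpaceB.norm_apply_le (f : SpaceB φ U) (x : X) : ‖f x‖ ≤ ‖φ‖ * ‖f‖ := by
  rcases (norm_nonneg φ).eq_or_lt with h0 | h0
  · obtain ⟨μ, rfl⟩ := f.of_surjective
    have := (norm_integralOp_le (sectionX φ) μ x).trans
      (mul_le_mul_of_nonneg_right (norm_sectionX_le x) (tv_nonneg μ))
    rw [← h0, zero_mul] at this ⊢
    exact this
  · rw [← div_le_iff₀' h0]
    refine f.le_norm fun μ hμ => ?_
    rw [div_le_iff₀' h0, ← hμ]
    exact (norm_integralOp_le (sectionX φ) μ x).trans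
      (mul_le_mul_of_nonneg_right (norm_sectionX_le x) (tv_nonneg μ))

lemma SpaceB.core : NormedSpace.Core ℝ (SpaceB φ U) where
  norm_nonneg f := f.le_norm fun μ _ => tv_nonneg μ
  norm_smul c f := by
    have key : ∀ (c : ℝ) (f : SpaceB φ U), ‖c • f‖ ≤ |c| * ‖f‖ := by
      intro c f
      rcases (abs_nonneg c).eq_or_lt with h0 | h0
      · have hc : c = 0 := abs_eq_zero.1 h0.symm
        subst hc
        have h1 : SpaceB.of φ (0 : radonMeasures Ω U) = (0 : ℝ) • f := by
          rw [zero_smul]; exact Subtype.ext (map_zero (opΩX φ U))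
        rw [← h1, abs_zero, zero_mul]
        exact (SpaceB.norm_le _).trans tv_zero.le
      · rw [← div_le_iff₀' h0]
        refine f.le_norm fun μ hμ => ?_
        rw [div_le_iff₀' h0, ← tv_smul]
        have h1 : SpaceB.of φ (c • μ) = c • f := by
          rw [← hμ]; exact Subtype.ext (map_smul (opΩX φ U) c μ)
        rw [← h1]
        exact SpaceB.norm_le _
    refine le_antisymm (key c f) ?_
    rcases eq_or_ne c 0 with rfl | hc
    · simp only [norm_zero, zero_mul]
      exact (SpaceB.le_norm _ fun μ _ => tv_nonneg μ)
    · have h := key c⁻¹ (c • f)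
      rw [inv_smul_smul₀ hc, abs_inv] at h
      rw [Real.norm_eq_abs]
      calc |c| * ‖f‖ ≤ |c| * (|c|⁻¹ * ‖c • f‖) := by gcongr
        _ = ‖c • f‖ := by
          rw [← mul_assoc, mul_inv_cancel₀ (abs_ne_zero.2 hc), one_mul]
  norm_triangle f g := by
    refine le_of_forall_pos_le_add fun ε hε => ?_
    obtain ⟨μ, rfl, hμ⟩ := f.exists_tv_lt (lt_add_of_pos_right _ (half_pos hε))
    obtain ⟨ν, rfl, hν⟩ := g.exists_tv_lt (lt_add_of_pos_right _ (half_pos hε))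
    have h1 : SpaceB.of φ (μ + ν) = SpaceB.of φ μ + SpaceB.of φ ν :=
      Subtype.ext (map_add (opΩX φ U) μ ν)
    have h2 := (SpaceB.norm_le (φ := φ) (μ + ν)).trans (tv_add_le μ ν)
    rw [h1] at h2
    linarith
  norm_eq_zero_iff f := by
    constructor
    · intro h
      refine Subtype.ext (funext fun x => ?_)
      have := f.norm_apply_le x
      rw [h, mul_zero] at this
      exact norm_le_zero_iff.1 this
    · rintro rfl
      have h1 : SpaceB.of φ (0 : radonMeasures Ω U) = 0 := Subtype.ext (map_zero (opΩX φ U))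
      refine le_antisymm ?_ (SpaceB.le_norm _ fun μ _ => tv_nonneg μ)
      rw [← h1]
      exact (SpaceB.norm_le _).trans tv_zero.le

noncomputable instance : NormedAddCommGroup (SpaceB φ U) := NormedAddCommGroup.ofCore SpaceB.core

noncomputable instance : NormedSpace ℝ (SpaceB φ U) := NormedSpace.ofCore SpaceB.core

lemma SpaceBDiamond.bddAbove (g : SpaceBDiamond φ U') : BddAbove (range fun w => ‖g w‖) := by
  obtain ⟨ρ, rfl⟩ := g.of_surjective
  refine ⟨‖φ‖ * tv ρ, ?_⟩
  rintro _ ⟨w, rfl⟩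
  exact (norm_integralOp_le (sectionΩ φ) ρ w).trans
      (mul_le_mul_of_nonneg_right (norm_sectionΩ_le w) (tv_nonneg ρ))

lemma SpaceBDiamond.norm_apply_le (g : SpaceBDiamond φ U') (w : Ω) : ‖g w‖ ≤ ‖g‖ :=
  le_ciSup g.bddAbove w

lemma SpaceBDiamond.core : NormedSpace.Core ℝ (SpaceBDiamond φ U') where
  norm_nonneg g := Real.iSup_nonneg fun w => norm_nonneg _
  norm_smul c g := by
    change (⨆ w, ‖c • g w‖) = ‖c‖ * ⨆ w, ‖g w‖
    simp_rw [norm_smul]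
    rw [Real.mul_iSup_of_nonneg (norm_nonneg c)]
  norm_triangle f g := by
    refine Real.iSup_le (fun w => ?_) (add_nonneg (Real.iSup_nonneg fun w => norm_nonneg _)
      (Real.iSup_nonneg fun w => norm_nonneg _))
    exact (norm_add_le (f w) (g w)).trans (add_le_add (f.norm_apply_le w) (g.norm_apply_le w))
  norm_eq_zero_iff g := by
    constructor
    · intro h
      refine Subtype.ext (funext fun w => ?_)
      have := g.norm_apply_le w
      rw [h] at this
      exact norm_le_zero_iff.1 this
    · rintro rfl
      change (⨆ w : Ω, ‖(0 : U')‖) = 0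
      simp

noncomputable instance : NormedAddCommGroup (SpaceBDiamond φ U') :=
  NormedAddCommGroup.ofCore SpaceBDiamond.core

noncomputable instance : NormedSpace ℝ (SpaceBDiamond φ U') :=
  NormedSpace.ofCore SpaceBDiamond.core

end Norms

section Pairing

/-- A dual pair `(U, U')` with continuous pairing `β = ⟨·, ·⟩_U : U' × U → ℝ`. -/
structure IsDualPair (β : U' →L[ℝ] U →L[ℝ] ℝ) : Prop where
  eq_zero_left : ∀ u : U, (∀ u' : U', β u' u = 0) → u = 0
  eq_zero_right : ∀ u' : U', (∀ u : U, β u' u = 0) → u' = 0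

/-- A twin operator over `(U, U')`: a bounded bilinear map `T : U' × U → ℝ` together with the linear
operators on `U` and on `U'` that represent it. -/
structure TwinOperator (β : U' →L[ℝ] U →L[ℝ] ℝ) where
  toBilin : U' →L[ℝ] U →L[ℝ] ℝ
  opU : U →ₗ[ℝ] U
  opDiamond : U' →ₗ[ℝ] U'
  pairing_opU : ∀ u' u, β u' (opU u) = toBilin u' u
  pairing_opDiamond : ∀ u' u, β (opDiamond u') u = toBilin u' u

/-- The kernel `K(x, w)(u', u) = φ(x, w) ⟨u', u⟩`, with `K_U(x, w) u = φ(x, w) u` and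
`K_{U'}(x, w) u' = φ(x, w) u'`. -/
noncomputable def kernel (φ : C₀(X × Ω, ℝ)) (β : U' →L[ℝ] U →L[ℝ] ℝ) (x : X) (w : Ω) :
    TwinOperator β where
  toBilin := φ (x, w) • β
  opU := φ (x, w) • LinearMap.id
  opDiamond := φ (x, w) • LinearMap.id
  pairing_opU := by simp
  pairing_opDiamond := by simp

/-- The point evaluation functional `δ_{x,u'}(f) = ⟨u', f(x)⟩_U`, an element of `𝓑^*`. -/
noncomputable def pointEval (φ : C₀(X × Ω, ℝ)) (β : U' →L[ℝ] U →L[ℝ] ℝ) (x : X) (u' : U') :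
    StrongDual ℝ (SpaceB φ U) :=
  LinearMap.mkContinuous
    { toFun := fun f => β u' (f x)
      map_add' := fun f g => map_add (β u') (f x) (g x)
      map_smul' := fun c f => map_smul (β u') c (f x) }
    (‖β u'‖ * ‖φ‖)
    (fun f => ((β u').le_opNorm (f x)).trans (by
      rw [mul_assoc]
      exact mul_le_mul_of_nonneg_left (f.norm_apply_le x) (norm_nonneg _)))

/-- The `δ`-dual of `𝓑`: the closure in `𝓑^*` of the span of the functionals `δ_{x,u'}`. -/
noncomputable def deltaDual (φ : C₀(X × Ω, ℝ)) (β : U' →L[ℝ] U →L[ℝ] ℝ) :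
    Submodule ℝ (StrongDual ℝ (SpaceB φ U)) :=
  (Submodule.span ℝ (range fun p : X × U' => pointEval φ β p.1 p.2)).topologicalClosure

variable [CompleteSpace U] [CompleteSpace U']

/-- The kernel section `K_{U'}(x, ·) u' = φ(x, ·) u'`, an element of `𝓑^◇`. -/
noncomputable def kernelSection (φ : C₀(X × Ω, ℝ)) (β : U' →L[ℝ] U →L[ℝ] ℝ) (x : X) (u' : U') :
    SpaceBDiamond φ U' :=
  ⟨fun w => (kernel φ β x w).opDiamond u', ⟨VectorMeasure.dirac x u', dirac_mem x u'⟩, by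
    funext w
    rw [opXΩ_apply, VectorMeasure.integral_dirac]
    rfl⟩

lemma kernelSection_apply (φ : C₀(X × Ω, ℝ)) (β : U' →L[ℝ] U →L[ℝ] ℝ) (x : X) (u' : U') (w : Ω) :
    kernelSection φ β x u' w = φ (x, w) • u' := rfl

/-- `∫_{X × Ω} φ d⟨ρ, μ⟩`, where `⟨ρ, μ⟩` is the signed measure on `X × Ω` with
`⟨ρ, μ⟩(E × F) = ⟨ρ(E), μ(F)⟩`. -/
noncomputable def measurePairing (φ : C₀(X × Ω, ℝ)) (β : U' →L[ℝ] U →L[ℝ] ℝ)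
    (ρ : radonMeasures X U') (μ : radonMeasures Ω U) : ℝ :=
  ∫ᵛ z, φ z ∂•((ρ : VectorMeasure X U').prod (μ : VectorMeasure Ω U) β)

variable {φ : C₀(X × Ω, ℝ)} {β : U' →L[ℝ] U →L[ℝ] ℝ}

lemma measurePairing_eq_left (ρ : radonMeasures X U') (μ : radonMeasures Ω U) :
    measurePairing φ β ρ μ = ∫ᵛ x, SpaceB.of φ μ x ∂[β.flip; (ρ : VectorMeasure X U')] :=
  (fubini_bounded _ _ β (stronglyMeasurable_C0_prod φ) (C := ‖φ‖)
    (fun z => φ.toBCF.norm_coe_le_norm z)).2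

lemma measurePairing_eq_right (ρ : radonMeasures X U') (μ : radonMeasures Ω U) :
    measurePairing φ β ρ μ = ∫ᵛ w, SpaceBDiamond.of φ ρ w ∂[β; (μ : VectorMeasure Ω U)] :=
  (fubini_bounded_swap _ _ β (stronglyMeasurable_C0_prod φ) (C := ‖φ‖)
    (fun z => φ.toBCF.norm_coe_le_norm z)).2

/-- The value `∫ φ d⟨ρ, μ⟩` depends only on the functions `A ρ` and `A μ`. -/
lemma measurePairing_congr {ρ ρ' : radonMeasures X U'} {μ μ' : radonMeasures Ω U}
    (hρ : SpaceBDiamond.of φ ρ = SpaceBDiamond.of φ ρ') (hμ : SpaceB.of φ μ = SpaceB.of φ μ') :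
    measurePairing φ β ρ μ = measurePairing φ β ρ' μ' := by
  rw [measurePairing_eq_right, hρ, ← measurePairing_eq_right, measurePairing_eq_left, hμ,
    ← measurePairing_eq_left]

lemma measurePairing_add_left (ρ ρ' : radonMeasures X U') (μ : radonMeasures Ω U) :
    measurePairing φ β (ρ + ρ') μ = measurePairing φ β ρ μ + measurePairing φ β ρ' μ := by
  have hm : StronglyMeasurable (fun x => SpaceB.of φ μ x) :=
    (fubini_bounded (ρ : VectorMeasure X U') (μ : VectorMeasure Ω U) β
      (stronglyMeasurable_C0_prod φ) (C := ‖φ‖) (fun z => φ.toBCF.norm_coe_le_norm z)).1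
  have hi : ∀ τ : radonMeasures X U',
      (τ : VectorMeasure X U').Integrable (fun x => SpaceB.of φ μ x) := fun τ =>
    Integrable.of_bound hm.aestronglyMeasurable _
      (Eventually.of_forall fun x => (SpaceB.of φ μ).norm_apply_le x)
  simp_rw [measurePairing_eq_left]
  exact VectorMeasure.integral_add_vectorMeasure (hi ρ) (hi ρ')

lemma measurePairing_add_right (ρ : radonMeasures X U') (μ μ' : radonMeasures Ω U) :
    measurePairing φ β ρ (μ + μ') = measurePairing φ β ρ μ + measurePairing φ β ρ μ' := by
  have hm : StronglyMeasurable (fun w => SpaceBDiamond.of φ ρ w) :=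
    (fubini_bounded_swap (ρ : VectorMeasure X U') (μ : VectorMeasure Ω U) β
      (stronglyMeasurable_C0_prod φ) (C := ‖φ‖) (fun z => φ.toBCF.norm_coe_le_norm z)).1
  have hi : ∀ τ : radonMeasures Ω U,
      (τ : VectorMeasure Ω U).Integrable (fun w => SpaceBDiamond.of φ ρ w) := fun τ =>
    Integrable.of_bound hm.aestronglyMeasurable _
      (Eventually.of_forall fun w => (SpaceBDiamond.of φ ρ).norm_apply_le w)
  simp_rw [measurePairing_eq_right]
  exact VectorMeasure.integral_add_vectorMeasure (hi μ) (hi μ')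

lemma measurePairing_smul_left (c : ℝ) (ρ : radonMeasures X U') (μ : radonMeasures Ω U) :
    measurePairing φ β (c • ρ) μ = c * measurePairing φ β ρ μ := by
  simp_rw [measurePairing_eq_left]
  exact VectorMeasure.integral_smul_vectorMeasure _ _

lemma measurePairing_smul_right (c : ℝ) (ρ : radonMeasures X U') (μ : radonMeasures Ω U) :
    measurePairing φ β ρ (c • μ) = c * measurePairing φ β ρ μ := by
  simp_rw [measurePairing_eq_right]
  exact VectorMeasure.integral_smul_vectorMeasure _ _

variable (φ β)

/-- The pairing `⟨g, f⟩_𝓑 = ∫_{X × Ω} φ d⟨ρ, μ⟩` for any representatives `g = A_{X→Ω} ρ` and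
`f = A_{Ω→X} μ`; see `pairing_of` for the independence of the representatives. -/
noncomputable def pairing : SpaceBDiamond φ U' →ₗ[ℝ] SpaceB φ U →ₗ[ℝ] ℝ :=
  LinearMap.mk₂ ℝ
    (fun g f => measurePairing φ β g.of_surjective.choose f.of_surjective.choose)
    (fun g g' f => by
      rw [← measurePairing_add_left]
      refine measurePairing_congr ?_ rfl
      rw [(g + g').of_surjective.choose_spec]
      conv_lhs => rw [← g.of_surjective.choose_spec, ← g'.of_surjective.choose_spec]
      exact Subtype.ext (map_add (opXΩ φ U') _ _).symm)
    (fun c g f => by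
      rw [smul_eq_mul, ← measurePairing_smul_left]
      refine measurePairing_congr ?_ rfl
      rw [(c • g).of_surjective.choose_spec]
      conv_lhs => rw [← g.of_surjective.choose_spec]
      exact Subtype.ext (map_smul (opXΩ φ U') _ _).symm)
    (fun g f f' => by
      rw [← measurePairing_add_right]
      refine measurePairing_congr rfl ?_
      rw [(f + f').of_surjective.choose_spec]
      conv_lhs => rw [← f.of_surjective.choose_spec, ← f'.of_surjective.choose_spec]
      exact Subtype.ext (map_add (opΩX φ U) _ _).symm)
    (fun c g f => by
      rw [smul_eq_mul, ← measurePairing_smul_right]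
      refine measurePairing_congr rfl ?_
      rw [(c • f).of_surjective.choose_spec]
      conv_lhs => rw [← f.of_surjective.choose_spec]
      exact Subtype.ext (map_smul (opΩX φ U) _ _).symm)

lemma pairing_of (ρ : radonMeasures X U') (μ : radonMeasures Ω U) :
    pairing φ β (SpaceBDiamond.of φ ρ) (SpaceB.of φ μ) =
      ∫ᵛ z, φ z ∂•((ρ : VectorMeasure X U').prod (μ : VectorMeasure Ω U) β) :=
  measurePairing_congr (SpaceBDiamond.of_surjective _).choose_spec
    (SpaceB.of_surjective _).choose_spec

end Pairing

end Spaces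

end VVRKBS

open VVRKBS

/-! Density. Since `φ` is continuous and vanishes at infinity, `x ↦ φ(x, ·)` is a continuous map
into the bounded functions on `Ω` with the sup norm, and it is uniformly small off a compact set. It
is therefore a uniform limit of simple functions `c` whose values are sections `φ(y, ·)` or `0`
(`exists_simpleFunc_abs_sub_lt`). Integrating `c` against `ρ` gives a finite sum of terms `φ(y, ·)
u'`, and the error is at most `sup |φ - c|` times `|ρ|(X)`, uniformly in `w`.

Duality. The two orders of integration express the pairing as an integral of `g` against `μ` or of
`f` against `ρ`. The first gives `|⟨g, f⟩| ≤ ‖β‖ ‖g‖ ‖f‖` after taking the infimum over `μ`. Taking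
`μ` to be a Dirac mass `δ_w u` recovers `⟨g(w), u⟩`, so a norming `β` makes `g ↦ ⟨g, ·⟩` isometric.
Taking `ρ = δ_x u'` in the second sends kernel sections to point evaluations. Density then
identifies the closure of the range with the `δ`-dual. -/

namespace VVRKBS

/-! ### Uniform approximation of `x ↦ φ(x, ·)` by simple functions -/

section Approximation

variable {X Ω : Type*} [TopologicalSpace X] [TopologicalSpace Ω]

lemma exists_isCompact_abs_lt (φ : C₀(X × Ω, ℝ)) {ε : ℝ} (hε : 0 < ε) :
    ∃ K : Set (X × Ω), IsCompact K ∧ ∀ z ∉ K, |φ z| < ε := by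
  have h := φ.zero_at_infty'
  rw [Metric.tendsto_nhds] at h
  obtain ⟨K, hK, hKs⟩ := mem_cocompact.1 (h ε hε)
  refine ⟨K, hK, fun z hz => ?_⟩
  simpa using hKs hz

/-- The sections `φ(·, w)` are equicontinuous. -/
lemma eventually_abs_sub_lt (φ : C₀(X × Ω, ℝ)) (x₀ : X) {ε : ℝ} (hε : 0 < ε) :
    ∀ᶠ x in 𝓝 x₀, ∀ w, |φ (x, w) - φ (x₀, w)| < ε := by
  obtain ⟨K, hK, hKε⟩ := exists_isCompact_abs_lt φ (half_pos hε)
  -- Over the compact projection of `K` to `Ω`, compactness makes joint continuity uniform in `w`.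
  -- Off it, both values are below `ε / 2` whatever the first coordinate.
  have hL : IsCompact (Prod.snd '' K) := hK.image continuous_snd
  have h := hL.eventually_forall_of_forall_eventually (x₀ := x₀)
    (P := fun x w => |φ (x, w) - φ (x₀, w)| < ε) fun w _ => by
      have hc : Continuous fun z : X × Ω => |φ (z.1, z.2) - φ (x₀, z.2)| :=
        ((map_continuous φ).sub ((map_continuous φ).comp (by fun_prop))).abs
      exact hc.continuousAt.eventually_lt continuousAt_const (by simpa using hε)
  filter_upwards [h] with x hx w
  by_cases hw : w ∈ Prod.snd '' K
  · exact hx w hw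
  · have hout : ∀ y : X, |φ (y, w)| < ε / 2 := fun y => hKε _ fun hy => hw ⟨_, hy, rfl⟩
    calc |φ (x, w) - φ (x₀, w)| ≤ |φ (x, w)| + |φ (x₀, w)| := abs_sub _ _
      _ < ε := by linarith [hout x, hout x₀]

/-- `x ↦ φ(x, ·)` is a uniform limit of simple functions with values in `0` and the sections
of `φ`. -/
lemma exists_simpleFunc_abs_sub_lt [MeasurableSpace X] [OpensMeasurableSpace X]
    (φ : C₀(X × Ω, ℝ)) {ε : ℝ} (hε : 0 < ε) :
    ∃ c : SimpleFunc X (Ω → ℝ), (∀ x, c x = 0 ∨ ∃ y, c x = fun w => φ (y, w)) ∧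
      ∀ x w, |φ (x, w) - c x w| < ε := by
  obtain ⟨K, hK, hKε⟩ := exists_isCompact_abs_lt φ hε
  -- Compactness induction visits arbitrary subsets `s`, so a measurable `B ⊇ s` is carried along to
  -- allow piecewise gluing. The restriction on the values of `c` is imposed on all of `X`, so
  -- gluing preserves it.
  let p : Set X → Prop := fun s => ∃ B : Set X, MeasurableSet B ∧ s ⊆ B ∧
    ∃ c : SimpleFunc X (Ω → ℝ), (∀ x, c x = 0 ∨ ∃ y, c x = fun w => φ (y, w)) ∧
      ∀ x ∈ B, ∀ w, |φ (x, w) - c x w| < ε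
  have hp : p (Prod.fst '' K) := by
    refine (hK.image continuous_fst).induction_on (p := p)
      ⟨∅, .empty, subset_rfl, 0, fun x => .inl rfl, by simp⟩ ?_ ?_ ?_
    · rintro s t hst ⟨B, hB, htB, h⟩
      exact ⟨B, hB, hst.trans htB, h⟩
    · rintro s t ⟨B, hB, hsB, c, hc, hcB⟩ ⟨B', hB', htB', c', hc', hcB'⟩
      refine ⟨B ∪ B', hB.union hB', union_subset_union hsB htB', c.piecewise B hB c', ?_, ?_⟩
      · intro x
        by_cases hx : x ∈ B
        · simpa [SimpleFunc.coe_piecewise, hx] using hc x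
        · simpa [SimpleFunc.coe_piecewise, hx] using hc' x
      · intro x hx w
        by_cases hxB : x ∈ B
        · simpa [SimpleFunc.coe_piecewise, hxB] using hcB x hxB w
        · simpa [SimpleFunc.coe_piecewise, hxB] using hcB' x (hx.resolve_left hxB) w
    · intro x₀ _
      -- Near `x₀` the constant simple function `φ(x₀, ·)` is already a good approximation, by
      -- equicontinuity.
      obtain ⟨N, hN, hNo, hxN⟩ := eventually_nhds_iff.1 (eventually_abs_sub_lt φ x₀ hε)
      exact ⟨N, mem_nhdsWithin_of_mem_nhds (hNo.mem_nhds hxN), N, hNo.measurableSet, subset_rfl,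
        SimpleFunc.const X fun w => φ (x₀, w), fun x => .inr ⟨x₀, rfl⟩, hN⟩
  obtain ⟨B, hB, hKB, c, hc, hcB⟩ := hp
  -- Off `B` the point `(x, w)` lies outside `K` for every `w`, so `|φ| < ε` there and the value `0`
  -- suffices.
  refine ⟨c.piecewise B hB 0, fun x => ?_, fun x w => ?_⟩
  · by_cases hx : x ∈ B
    · simpa [SimpleFunc.coe_piecewise, hx] using hc x
    · simp [SimpleFunc.coe_piecewise, hx]
  · by_cases hx : x ∈ B
    · simpa [SimpleFunc.coe_piecewise, hx] using hcB x hx w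
    · simpa [SimpleFunc.coe_piecewise, hx] using hKε (x, w) fun h => hx (hKB ⟨_, h, rfl⟩)

/-- The vectors `ρ (c ⁻¹' {h})` do not depend on `w`, so as a function of `w` the integral is a
finite combination of the values `h` of `c`. -/
lemma integral_simpleFunc_apply {F : Type*} [MeasurableSpace X] [NormedAddCommGroup F]
    [NormedSpace ℝ F] [CompleteSpace F] (ρ : VectorMeasure X F) [IsFiniteMeasure ρ.variation]
    (c : SimpleFunc X (Ω → ℝ)) (w : Ω) :
    ∫ᵛ x, c x w ∂•ρ = ∑ h ∈ c.range, h w • ρ (c ⁻¹' {h}) := by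
  have h1 : ∀ x, c x w = ∑ h ∈ c.range, (c ⁻¹' {h}).indicator (fun _ => h w) x := by
    intro x
    rw [Finset.sum_eq_single (c x)]
    · simp
    · intro h _ hne
      exact indicator_of_notMem (s := c ⁻¹' {h}) (fun hx => hne (Eq.symm hx)) fun _ => h w
    · exact fun hx => (hx (c.mem_range_self x)).elim
  simp_rw [h1]
  rw [VectorMeasure.integral_finsetSum]
  · refine Finset.sum_congr rfl fun h _ => ?_
    rw [VectorMeasure.integral_indicator_const _ (c.measurableSet_fiber h)]
    simp
  · exact fun h _ => (integrable_const (h w)).indicator (c.measurableSet_fiber h)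

end Approximation

/-! ### Density of the kernel sections -/

section Duality

variable {X Ω : Type*} [TopologicalSpace X] [T2Space X] [MeasurableSpace X] [BorelSpace X]
  [TopologicalSpace Ω] [T2Space Ω] [MeasurableSpace Ω] [BorelSpace Ω]
  {U U' : Type*} [NormedAddCommGroup U] [NormedSpace ℝ U] [CompleteSpace U]
  [NormedAddCommGroup U'] [NormedSpace ℝ U'] [CompleteSpace U']
  (φ : C₀(X × Ω, ℝ)) (β : U' →L[ℝ] U →L[ℝ] ℝ)

/-- The condition `0 ≤ C` covers empty `Ω`, where the supremum is `0` by convention. -/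
lemma SpaceBDiamond.norm_le_of_forall {g : SpaceBDiamond φ U'} {C : ℝ} (hC : 0 ≤ C)
    (h : ∀ w, ‖g w‖ ≤ C) : ‖g‖ ≤ C :=
  Real.iSup_le h hC

lemma kernelSection_eq_of (x : X) (u' : U') :
    kernelSection φ β x u' = SpaceBDiamond.of φ ⟨VectorMeasure.dirac x u', dirac_mem x u'⟩ :=
  Subtype.ext <| funext fun w => by
    change φ (x, w) • u' = ∫ᵛ y, φ (y, w) ∂•(VectorMeasure.dirac x u')
    rw [VectorMeasure.integral_dirac]
    rfl

/-- In effect `ρ` is replaced by finitely many point masses: each fibre of `c` with value `φ(y, ·)`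
has its `ρ`-mass moved to `y`, and fibres with value `0` are dropped. -/
theorem dense_span_kernelSection :
    Dense (Submodule.span ℝ (range fun p : X × U' => kernelSection φ β p.1 p.2) :
      Set (SpaceBDiamond φ U')) := by
  intro g
  obtain ⟨ρ, rfl⟩ := g.of_surjective
  rw [Metric.mem_closure_iff]
  intro ε hε
  have htv := tv_nonneg ρ
  -- The `+ 1` keeps the denominator positive when `tv ρ = 0`; in all cases `δ * tv ρ < ε`.
  set δ := ε / (2 * (tv ρ + 1)) with hδ
  have hδ0 : 0 < δ := by positivity
  obtain ⟨c, hc, hcδ⟩ := exists_simpleFunc_abs_sub_lt φ hδ0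
  have hspan : ∀ h ∈ c.range, ∀ u' : U',
      ∃ k ∈ Submodule.span ℝ (range fun p : X × U' => kernelSection φ β p.1 p.2),
        ∀ w, k w = h w • u' := by
    intro h hh u'
    obtain ⟨x, rfl⟩ := SimpleFunc.mem_range.1 hh
    rcases hc x with h0 | ⟨y, hy⟩
    · exact ⟨0, zero_mem _, fun w => by rw [h0, Pi.zero_apply, zero_smul]; rfl⟩
    · exact ⟨_, Submodule.subset_span ⟨(y, u'), rfl⟩, fun w => by rw [hy]; rfl⟩
  have hsum : ∃ k ∈ Submodule.span ℝ (range fun p : X × U' => kernelSection φ β p.1 p.2),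
      ∀ w, k w = ∫ᵛ x, c x w ∂•(ρ : VectorMeasure X U') := by
    choose! k hk hkw using hspan
    refine ⟨∑ h ∈ c.range, k h ((ρ : VectorMeasure X U') (c ⁻¹' {h})),
      Submodule.sum_mem _ fun h hh => hk h hh _, fun w => ?_⟩
    rw [integral_simpleFunc_apply]
    -- Evaluation at `w` is linear on the function space, hence commutes with the finite sum.
    have hev := map_sum ((LinearMap.proj w : (Ω → U') →ₗ[ℝ] U') ∘ₗ
      (LinearMap.range (opXΩ φ U')).subtype)
      (fun h => k h ((ρ : VectorMeasure X U') (c ⁻¹' {h}))) c.range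
    exact hev.trans (Finset.sum_congr rfl fun h hh => hkw h hh _ w)
  obtain ⟨k, hk, hkw⟩ := hsum
  refine ⟨k, hk, ?_⟩
  rw [dist_eq_norm]
  have hle : ‖SpaceBDiamond.of φ ρ - k‖ ≤ δ * tv ρ := by
    refine SpaceBDiamond.norm_le_of_forall φ (by positivity) fun w => ?_
    have hsub : (SpaceBDiamond.of φ ρ - k) w =
        ∫ᵛ x, (φ (x, w) - c x w) ∂•(ρ : VectorMeasure X U') := by
      have hcm : StronglyMeasurable fun x => c x w := 
        (c.map fun h : Ω → ℝ => h w).stronglyMeasurable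
      have hci : (ρ : VectorMeasure X U').Integrable fun x => c x w := by
        obtain ⟨C, hC⟩ := (c.map fun h : Ω → ℝ => h w).exists_forall_norm_le
        exact Integrable.of_bound hcm.aestronglyMeasurable C (Eventually.of_forall hC)
      refine Eq.trans ?_ (VectorMeasure.integral_fun_sub (integrable_bcf (sectionΩ φ w) _) hci).symm
      rw [← hkw]
      rfl
    rw [hsub]
    refine (VectorMeasure.norm_integral_le_of_norm_le_const (C := δ)
      (Eventually.of_forall fun x => (hcδ x w).le)).trans ?_
    have h1 : ‖(ContinuousLinearMap.lsmul ℝ ℝ : ℝ →L[ℝ] U' →L[ℝ] U')‖ ≤ 1 :=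
      ContinuousLinearMap.opNorm_lsmul_le
    exact mul_le_mul_of_nonneg_right (mul_le_of_le_one_right hδ0.le h1) htv
  refine hle.trans_lt ?_
  rw [hδ, div_mul_eq_mul_div, div_lt_iff₀ (by positivity)]
  nlinarith

/-! ### The pairing and the isometry into the dual of `𝓑` -/

variable {φ β}

lemma pairing_of_right (g : SpaceBDiamond φ U') (μ : radonMeasures Ω U) :
    pairing φ β g (SpaceB.of φ μ) = ∫ᵛ w, g w ∂[β; (μ : VectorMeasure Ω U)] := by
  obtain ⟨ρ, rfl⟩ := g.of_surjective
  exact (pairing_of φ β ρ μ).trans (measurePairing_eq_right ρ μ)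

/-- The section is represented by a Dirac mass at `x`, against which the integral of `f` collapses
to its value at `x`. -/
lemma pairing_kernelSection (x : X) (u' : U') (f : SpaceB φ U) :
    pairing φ β (kernelSection φ β x u') f = β u' (f x) := by
  obtain ⟨μ, rfl⟩ := f.of_surjective
  rw [kernelSection_eq_of, pairing_of]
  refine (measurePairing_eq_left _ μ).trans ?_
  rw [VectorMeasure.integral_dirac]
  rfl

lemma abs_pairing_le (g : SpaceBDiamond φ U') (f : SpaceB φ U) :
    |pairing φ β g f| ≤ ‖β‖ * ‖g‖ * ‖f‖ := by
  have h : ∀ μ, SpaceB.of φ μ = f → |pairing φ β g f| ≤ ‖β‖ * ‖g‖ * tv μ := by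
    rintro μ rfl
    rw [pairing_of_right, mul_comm ‖β‖, ← Real.norm_eq_abs]
    exact VectorMeasure.norm_integral_le_of_norm_le_const
      (Eventually.of_forall fun w => g.norm_apply_le w)
  -- The bound holds for every `μ` representing `f`. Passing to the infimum divides by `‖β‖ * ‖g‖`,
  -- so the case where this product vanishes is separate.
  have h0 : 0 ≤ ‖β‖ * ‖g‖ := by positivity
  rcases h0.eq_or_lt with h1 | h1
  · obtain ⟨μ, hμ⟩ := f.of_surjective
    have := h μ hμ
    rwa [← h1, zero_mul] at this ⊢
  · rw [← div_le_iff₀' h1]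
    exact f.le_norm fun μ hμ => (div_le_iff₀' h1).2 (h μ hμ)

lemma tv_dirac (w : Ω) (u : U) : tv ⟨VectorMeasure.dirac w u, dirac_mem w u⟩ = ‖u‖ := by
  simp [tv, VectorMeasure.variation_dirac]

lemma opNorm_le_one_of_isLUB
    (hnorm : ∀ u' : U', IsLUB {r : ℝ | ∃ u : U, ‖u‖ ≤ 1 ∧ r = |β u' u|} ‖u'‖) : ‖β‖ ≤ 1 := by
  refine β.opNorm_le_bound zero_le_one fun u' => ?_
  rw [one_mul]
  exact ContinuousLinearMap.opNorm_le_of_unit_norm (norm_nonneg _)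
    fun u hu => (hnorm u').1 ⟨u, hu.le, rfl⟩

/-- A norming `β` has norm at most `1`, which gives the upper bound. For sharpness, the image of the
Dirac mass `δ_w u` has norm at most `‖u‖` and pairs with `g` to `⟨g(w), u⟩`; the supremum over
unit-ball `u` is `‖g(w)‖`. -/
theorem isLUB_abs_pairing
    (hnorm : ∀ u' : U', IsLUB {r : ℝ | ∃ u : U, ‖u‖ ≤ 1 ∧ r = |β u' u|} ‖u'‖)
    (g : SpaceBDiamond φ U') :
    IsLUB {r : ℝ | ∃ f : SpaceB φ U, ‖f‖ ≤ 1 ∧ r = |pairing φ β g f|} ‖g‖ := by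
  constructor
  · rintro _ ⟨f, hf, rfl⟩
    calc |pairing φ β g f| ≤ ‖β‖ * ‖g‖ * ‖f‖ := abs_pairing_le g f
      _ ≤ 1 * ‖g‖ * 1 := by gcongr; exact opNorm_le_one_of_isLUB hnorm
      _ = ‖g‖ := by ring
  · intro C hC
    refine SpaceBDiamond.norm_le_of_forall φ ?_ fun w => (hnorm (g w)).2 ?_
    -- Testing on `f = 0` gives `0 ≤ C`, which no point `w` supplies if `Ω` is empty.
    · exact hC ⟨0, by simp, by simp⟩
    · rintro _ ⟨u, hu, rfl⟩
      refine hC ⟨SpaceB.of φ ⟨VectorMeasure.dirac w u, dirac_mem w u⟩,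
        (SpaceB.norm_le _).trans ((tv_dirac w u).trans_le hu), ?_⟩
      rw [pairing_of_right, VectorMeasure.integral_dirac]

variable (φ β) in
/-- The linear map `g ↦ ⟨g, ·⟩` into the continuous dual of `𝓑`. -/
noncomputable def toDual : SpaceBDiamond φ U' →ₗ[ℝ] StrongDual ℝ (SpaceB φ U) where
  toFun g := (pairing φ β g).mkContinuous (‖β‖ * ‖g‖) (abs_pairing_le g)
  map_add' g g' := by ext f; simp
  map_smul' c g := by ext f; simp

lemma toDual_apply (g : SpaceBDiamond φ U') (f : SpaceB φ U) :
    toDual φ β g f = pairing φ β g f := rfl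

lemma norm_toDual
    (hnorm : ∀ u' : U', IsLUB {r : ℝ | ∃ u : U, ‖u‖ ≤ 1 ∧ r = |β u' u|} ‖u'‖)
    (g : SpaceBDiamond φ U') : ‖toDual φ β g‖ = ‖g‖ := by
  apply le_antisymm
  · exact ContinuousLinearMap.opNorm_le_of_unit_norm (norm_nonneg _)
      fun f hf => (isLUB_abs_pairing hnorm g).1 ⟨f, hf.le, rfl⟩
  · refine (isLUB_abs_pairing hnorm g).2 ?_
    rintro _ ⟨f, hf, rfl⟩
    exact (toDual φ β g).unit_le_opNorm f hf

lemma toDual_kernelSection (x : X) (u' : U') :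
    toDual φ β (kernelSection φ β x u') = pointEval φ β x u' :=
  ContinuousLinearMap.ext fun f => pairing_kernelSection x u' f

end Duality

end VVRKBS

theorem mainTheorem11 {X Ω U U' : Type*}
    [TopologicalSpace X] [T2Space X] [LocallyCompactSpace X] [MeasurableSpace X] [BorelSpace X]
    [TopologicalSpace Ω] [T2Space Ω] [LocallyCompactSpace Ω] [MeasurableSpace Ω] [BorelSpace Ω]
    [NormedAddCommGroup U] [NormedSpace ℝ U] [CompleteSpace U]
    [NormedAddCommGroup U'] [NormedSpace ℝ U'] [CompleteSpace U']
    (β : U' →L[ℝ] U →L[ℝ] ℝ) (hβ : IsDualPair β) (φ : C₀(X × Ω, ℝ)) :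
    Dense (Submodule.span ℝ (Set.range fun p : X × U' => kernelSection φ β p.1 p.2) :
      Set (SpaceBDiamond φ U')) ∧
    ((∀ u' : U', IsLUB {r : ℝ | ∃ u : U, ‖u‖ ≤ 1 ∧ r = |β u' u|} ‖u'‖) →
      (∀ g : SpaceBDiamond φ U',
        IsLUB {r : ℝ | ∃ f : SpaceB φ U, ‖f‖ ≤ 1 ∧ r = |pairing φ β g f|} ‖g‖) ∧
      ∃ ι : SpaceBDiamond φ U' →ₗᵢ[ℝ] StrongDual ℝ (SpaceB φ U),
        (∀ g f, ι g f = pairing φ β g f) ∧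
        (∀ x u', ι (kernelSection φ β x u') = pointEval φ β x u') ∧
        closure (Set.range ι) = (deltaDual φ β : Set (StrongDual ℝ (SpaceB φ U))) ∧
        (CompleteSpace (SpaceBDiamond φ U') →
          Set.range ι = (deltaDual φ β : Set (StrongDual ℝ (SpaceB φ U))))) := by
  refine ⟨dense_span_kernelSection φ β, fun hnorm => ⟨isLUB_abs_pairing hnorm, ?_⟩⟩
  let ι : SpaceBDiamond φ U' →ₗᵢ[ℝ] StrongDual ℝ (SpaceB φ U) := ⟨toDual φ β, norm_toDual hnorm⟩
  have hker : ∀ x u', ι (kernelSection φ β x u') = pointEval φ β x u' := toDual_kernelSection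
  -- By linearity the correspondence of generators extends to the spans, so the dense subspace of
  -- `𝓑^◇` maps exactly onto `Δ`.
  have hmap : ι '' (Submodule.span ℝ (Set.range fun p : X × U' => kernelSection φ β p.1 p.2)) =
      (Submodule.span ℝ (Set.range fun p : X × U' => pointEval φ β p.1 p.2) :
        Set (StrongDual ℝ (SpaceB φ U))) := by
    have h := Submodule.map_span ι.toLinearMap
      (Set.range fun p : X × U' => kernelSection φ β p.1 p.2)
    rw [← Set.range_comp] at h
    have hfun : ι.toLinearMap ∘ (fun p : X × U' => kernelSection φ β p.1 p.2) =
        fun p => pointEval φ β p.1 p.2 := funext fun p => hker p.1 p.2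
    rw [hfun] at h
    exact congrArg SetLike.coe h
  have hclosure : closure (Set.range ι) =
      (deltaDual φ β : Set (StrongDual ℝ (SpaceB φ U))) := by
    rw [deltaDual, Submodule.topologicalClosure_coe, ← hmap]
    -- Continuity places the whole range inside the closure of the image of a dense set; the other
    -- inclusion is monotonicity.
    refine (closure_minimal ?_ isClosed_closure).antisymm (closure_mono (Set.image_subset_range _ _))
    exact ι.continuous.range_subset_closure_image_dense (dense_span_kernelSection φ β)
  refine ⟨ι, fun g f => rfl, hker, hclosure, fun _ => ?_⟩
  -- An isometric image of a complete space is closed.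
  rw [← hclosure, ι.isometry.isClosedEmbedding.isClosed_range.closure_eq]
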